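/- Let $X=\{\Omega,\mathcal F,(\mathcal F_t)_{t\ge0},(X_t)_{t\ge 0},(\mathbb P_x)_{x\in\mathbb R^d}\}$ be a Feller process on $\mathbb R^d$, that is, a time-homogeneous Markov process with values in the one-point compactification $\mathbb R^d\cup\{\Delta\}$, with $\mathbb P_x(X_0=x)=1$, whose paths are $\mathbb P_x$-almost surely right continuous with left limits in $\mathbb R^d\cup\{\Delta\}$ for every $x\in\mathbb R^d$, and such that the operators $T_tu(x)=\mathbb E_x[u(X_t)]$ (with $u(\Delta)=0$) map the space $C_\infty(\mathbb R^d)$ of continuous functions vanishing at infinity into itself and satisfy $\|T_tu-u\|_\infty\to0$ as $t\downarrow 0$ for every $u\in C_\infty(\mathbb R^d)$. Let $(L,D(L))$ be its Feller generator: $D(L)$ is the set of $u\in C_\infty(\mathbb R^d)$ for which $Lu:=\lim_{t\downarrow0}(T_tu-u)/t$ exists in $(C_\infty(\mathbb R^d),\|\cdot\|_\infty)$. Suppose that $C_c^\infty(\mathbb R^d)\subset D(L)$ and that, for all $u\in C_c^\infty(\mathbb R^d)$ and $x\in\mathbb R^d$, $$Lu(x)=\int_{\mathbb R^d\setminus\{0\}}\bigl(u(x+z)-u(x)-\langle\nabla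 u(x),z\rangle\mathbf 1_{\{|z|<1\}}(z)\bigr)\,N(x,dz),$$ where for each $x$, $N(x,dz)$ is a non-negative measure on $\mathbb R^d\setminus\{0\}$ and $$\sup_{x\in\mathbb R^d}\int_{\mathbb R^d\setminus\{0\}}|z|^2\,N(x,dz)<\infty.$$ Then, for all $t>0$, $i=1,\dots,d$ and $x_0\in\mathbb R^d$: $X_t\in\mathbb R^d$ holds $\mathbb P_{x_0}$-almost surely, $X_t^{(i)}$ has finite second moment under $\mathbb P_{x_0}$, and $$\mathbb E_{x_0}\bigl[(X_t^{(i)}-x_0^{(i)})^2\bigr]=\mathbb E_{x_0}\Bigl[\int_0^t\Bigl(\int_{\mathbb R^d\setminus\{0\}}(z^{(i)})^2N(X_s,dz)\Bigr)ds\Bigr]+2\,\mathbb E_{x_0}\Bigl[\int_0^t(X_s^{(i)}-x_0^{(i)})\Bigl(\int_{\{|z|\ge1\}}z^{(i)}N(X_s,dz)\Bigr)ds\Bigr]<\infty,$$ $$\mathbb E_{x_0}\bigl[X_t^{(i)}-x_0^{(i)}\bigr]=\mathbb E_{x_0}\Bigl[\int_0^t\Bigl(\int_{\{|z|\ge1\}}z^{(i)}N(X_s,dz)\Bigr)ds\Bigr],$$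 where the integrands of the three time integrals on the right-hand sides are absolutely integrable with respect to $ds\otimes\mathbb P_{x_0}$ on $(0,t]\times\Omega$. -/

import Mathlib

open MeasureTheory Filter Topology
open scoped NNReal ENNReal ZeroAtInfty

noncomputable section

namespace FellerMoment

/-- The one-point compactification `ℝᵈ ∪ {Δ}`; the cemetery `Δ` is `OnePoint.infty`. -/
abbrev Compactified (d : ℕ) : Type := OnePoint (EuclideanSpace ℝ (Fin d))

instance instMeasurableSpaceCompactified (d : ℕ) : MeasurableSpace (Compactified d) :=
  borel (Compactified d)

instance instBorelSpaceCompactified (d : ℕ) : BorelSpace (Compactified d) := ⟨rfl⟩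

/-- The usual extension of a function on `ℝᵈ` to `ℝᵈ ∪ {Δ}` by `u(Δ) = 0`. -/
def extendZero {d : ℕ} (u : EuclideanSpace ℝ (Fin d) → ℝ) : Compactified d → ℝ :=
  fun p => OnePoint.elim p 0 u

/-- The point of `ℝᵈ` underlying a point of `ℝᵈ ∪ {Δ}`. The value at `Δ` is a placeholder. -/
def position {d : ℕ} : Compactified d → EuclideanSpace ℝ (Fin d) :=
  fun p => OnePoint.elim p 0 id

/-- `T_t u(x) = 𝔼_x[u(X_t)]`, with `u(Δ) = 0`. -/
def transition {d : ℕ} {Ω : Type*} [MeasurableSpace Ω] (X : ℝ≥0 → Ω → Compactified d)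
    (P : EuclideanSpace ℝ (Fin d) → Measure Ω) (t : ℝ≥0)
    (u : EuclideanSpace ℝ (Fin d) → ℝ) (x : EuclideanSpace ℝ (Fin d)) : ℝ :=
  ∫ ω, extendZero u (X t ω) ∂(P x)

/-- A Feller process on `ℝᵈ`. It is not assumed to be conservative: a path may be sent to `Δ`. -/
structure FellerProcess (d : ℕ) (Ω : Type*) [mΩ : MeasurableSpace Ω] where
  /-- the process -/
  X : ℝ≥0 → Ω → Compactified d
  /-- the filtration -/
  ℱ : Filtration ℝ≥0 mΩ
  /-- the law of the process started at a point of `ℝᵈ` -/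
  P : EuclideanSpace ℝ (Fin d) → Measure Ω
  isProbabilityMeasure : ∀ x, IsProbabilityMeasure (P x)
  adapted : ∀ t, Measurable[ℱ t] (X t)
  start : ∀ x : EuclideanSpace ℝ (Fin d), ∀ᵐ ω ∂(P x), X 0 ω = OnePoint.some x
  /-- time-homogeneous Markov property, for bounded Borel functions -/
  markov : ∀ (x : EuclideanSpace ℝ (Fin d)) (s t : ℝ≥0) (u : EuclideanSpace ℝ (Fin d) → ℝ),
    Measurable u → (∃ C : ℝ, ∀ y, |u y| ≤ C) →
    (P x)[fun ω => extendZero u (X (s + t) ω) | ℱ s]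
      =ᵐ[P x] fun ω => extendZero (transition X P t u) (X s ω)
  /-- Feller property: `T_t` maps `C_∞(ℝᵈ)` into itself -/
  feller : ∀ (t : ℝ≥0) (u : C₀(EuclideanSpace ℝ (Fin d), ℝ)),
    ∃ v : C₀(EuclideanSpace ℝ (Fin d), ℝ), ∀ x, v x = transition X P t u x
  /-- strong continuity: `T_t u → u` uniformly as `t ↓ 0` -/
  strongly_continuous : ∀ u : C₀(EuclideanSpace ℝ (Fin d), ℝ),
    TendstoUniformly (fun t : ℝ≥0 => transition X P t u) u (𝓝[>] 0)
  /-- almost surely the paths are right continuous with left limits in `ℝᵈ ∪ {Δ}` -/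
  cadlag : ∀ x, ∀ᵐ ω ∂(P x), ∀ t : ℝ≥0,
    ContinuousWithinAt (fun s => X s ω) (Set.Ici t) t ∧
      ∃ l : Compactified d, Tendsto (fun s => X s ω) (𝓝[<] t) (𝓝 l)

namespace FellerProcess

variable {d : ℕ} {Ω : Type*} [MeasurableSpace Ω]

/-- The Feller semigroup `(T_t)` acting on `C_∞(ℝᵈ)`. -/
def semigroup (𝕏 : FellerProcess d Ω) (t : ℝ≥0) (u : C₀(EuclideanSpace ℝ (Fin d), ℝ)) :
    C₀(EuclideanSpace ℝ (Fin d), ℝ) :=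
  Classical.choose (𝕏.feller t u)

theorem semigroup_apply (𝕏 : FellerProcess d Ω) (t : ℝ≥0)
    (u : C₀(EuclideanSpace ℝ (Fin d), ℝ)) (x : EuclideanSpace ℝ (Fin d)) :
    𝕏.semigroup t u x = ∫ ω, extendZero u (𝕏.X t ω) ∂(𝕏.P x) :=
  Classical.choose_spec (𝕏.feller t u) x

/-- `u ∈ D(L)` and `Lu = v`: `(T_t u - u) / t → v` in the sup norm as `t ↓ 0`. -/
def HasGenerator (𝕏 : FellerProcess d Ω) (u v : C₀(EuclideanSpace ℝ (Fin d), ℝ)) : Prop :=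
  Tendsto (fun t : ℝ≥0 => (t : ℝ)⁻¹ • (𝕏.semigroup t u - u)) (𝓝[>] 0) (𝓝 v)

/-- The domain `D(L)` of the Feller generator. -/
def generatorDomain (𝕏 : FellerProcess d Ω) : Set C₀(EuclideanSpace ℝ (Fin d), ℝ) :=
  {u | ∃ v, 𝕏.HasGenerator u v}

open Classical in
/-- The Feller generator `L` (only meaningful on `D(L)`). -/
def generator (𝕏 : FellerProcess d Ω) (u : C₀(EuclideanSpace ℝ (Fin d), ℝ)) :
    C₀(EuclideanSpace ℝ (Fin d), ℝ) :=
  if h : ∃ v, 𝕏.HasGenerator u v then Classical.choose h else 0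

/-- The coordinate `X_t^{(i)}`. -/
def coord (𝕏 : FellerProcess d Ω) (i : Fin d) (t : ℝ≥0) (ω : Ω) : ℝ :=
  position (𝕏.X t ω) i

end FellerProcess

/-- The pure-jump integro-differential expression
`∫_{ℝᵈ∖{0}} (u(x+z) - u(x) - ⟨∇u(x), z⟩ 1_{|z|<1}) N(x, dz)`. A measure on `ℝᵈ∖{0}` is given as a
measure on `ℝᵈ` of which only the restriction to `{0}ᶜ` is used. -/
def jumpOperator {d : ℕ} (N : EuclideanSpace ℝ (Fin d) → Measure (EuclideanSpace ℝ (Fin d)))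
    (u : EuclideanSpace ℝ (Fin d) → ℝ) (x : EuclideanSpace ℝ (Fin d)) : ℝ :=
  ∫ z in {0}ᶜ, (u (x + z) - u x -
    Set.indicator {z | ‖z‖ < 1} (fun z => (inner ℝ (gradient u x) z : ℝ)) z) ∂(N x)

/-- The generator of `𝕏` is of pure-jump type with jumping kernel `N`, whose second moment is
uniformly bounded. -/
structure IsPureJump {d : ℕ} {Ω : Type*} [MeasurableSpace Ω] (𝕏 : FellerProcess d Ω)
    (N : EuclideanSpace ℝ (Fin d) → Measure (EuclideanSpace ℝ (Fin d))) : Prop where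
  smooth_mem_domain : ∀ u : C₀(EuclideanSpace ℝ (Fin d), ℝ),
    ContDiff ℝ ((⊤ : ℕ∞) : WithTop ℕ∞) u → HasCompactSupport u → u ∈ 𝕏.generatorDomain
  generator_eq : ∀ u : C₀(EuclideanSpace ℝ (Fin d), ℝ),
    ContDiff ℝ ((⊤ : ℕ∞) : WithTop ℕ∞) u → HasCompactSupport u → ∀ x, 𝕏.generator u x = jumpOperator N u x
  second_moment : (⨆ x : EuclideanSpace ℝ (Fin d), ∫⁻ z in {0}ᶜ, ‖z‖ₑ ^ 2 ∂(N x)) < (⊤ : ℝ≥0∞)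

/-- `∫_{ℝᵈ∖{0}} (z^{(i)})² N(x, dz)`. -/
def jumpSecondMoment {d : ℕ} (N : EuclideanSpace ℝ (Fin d) → Measure (EuclideanSpace ℝ (Fin d)))
    (i : Fin d) (x : EuclideanSpace ℝ (Fin d)) : ℝ :=
  ∫ z in {0}ᶜ, (z i) ^ 2 ∂(N x)

/-- `∫_{|z|≥1} z^{(i)} N(x, dz)`. -/
def largeJumpMean {d : ℕ} (N : EuclideanSpace ℝ (Fin d) → Measure (EuclideanSpace ℝ (Fin d)))
    (i : Fin d) (x : EuclideanSpace ℝ (Fin d)) : ℝ :=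
  ∫ z in {z | 1 ≤ ‖z‖}, z i ∂(N x)

end FellerMoment

end

/-! Each polynomial $p_k(y)=(y_i-x_{0,i})^k$, $k=0,1,2$, is approximated by smooth compactly
supported truncations $u_n$. For these, Dynkin's formula
$T_tu_n(x_0)-u_n(x_0)=\int_0^tT_sLu_n(x_0)\,ds$ is available (`integral_semigroup_generator`), and
$n\to\infty$ then gives the result.

The truncations are rescalings of one fixed function, so their Taylor remainders are at most
$K(n+1)^{k-2}|z|^2$. With the uniform second moment of $N$ this controls $Lu_n$. For $k=0$,
$Lu_n\to0$ uniformly, so no mass reaches $\Delta$ (`ae_ne_infty`). For $k=2$ a nonnegative function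
with quadratic Taylor remainder satisfies $|\nabla u|^2\le4Ku$ (`norm_fderiv_sq_le`), hence
$|Lu_n|\le C(1+u_n)$ with $C$ independent of $n$. Gronwall's lemma bounds $T_su_n(x_0)$ uniformly in
$n$ and $s\le t$, and Fatou's lemma yields finite second moments. These moments dominate the passage
to the limit for $k=1,2$ (`integral_coord_sub_pow`). Evaluating $Lp_1$ and $Lp_2$ explicitly
produces the stated integrands. -/

noncomputable section

namespace FellerMoment

variable {d : ℕ}

/-! ### Functions on the one-point compactification. -/

@[simp] theorem extendZero_coe (u : EuclideanSpace ℝ (Fin d) → ℝ) (x : EuclideanSpace ℝ (Fin d)) :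
    extendZero u (x : Compactified d) = u x := rfl

@[simp] theorem extendZero_infty (u : EuclideanSpace ℝ (Fin d) → ℝ) :
    extendZero u OnePoint.infty = 0 := rfl

theorem extendZero_sub (u v : EuclideanSpace ℝ (Fin d) → ℝ) (p : Compactified d) :
    extendZero (u - v) p = extendZero u p - extendZero v p := by
  induction p using OnePoint.rec <;> simp

theorem extendZero_smul (c : ℝ) (u : EuclideanSpace ℝ (Fin d) → ℝ) (p : Compactified d) :
    extendZero (c • u) p = c • extendZero u p := by
  induction p using OnePoint.rec <;> simp

@[simp] theorem position_coe (x : EuclideanSpace ℝ (Fin d)) :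
    position (x : Compactified d) = x := rfl

@[simp] theorem position_infty : position (OnePoint.infty : Compactified d) = 0 := rfl

theorem measurableEmbedding_coe :
    MeasurableEmbedding ((↑) : EuclideanSpace ℝ (Fin d) → Compactified d) :=
  OnePoint.isOpenEmbedding_coe.measurableEmbedding

theorem measurable_extendZero {u : EuclideanSpace ℝ (Fin d) → ℝ} (hu : Measurable u) :
    Measurable (extendZero u) := by
  have h := (measurableEmbedding_coe (d := d)).measurable_extend hu
    (measurable_const (a := (0 : ℝ)))
  convert h using 1
  funext p
  induction p using OnePoint.rec with
  | infty =>
    rw [Function.extend_apply']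
    · rfl
    · rintro ⟨x, hx⟩
      exact OnePoint.coe_ne_infty x hx
  | coe x => exact (measurableEmbedding_coe.injective.extend_apply _ _ _).symm

theorem measurable_position : Measurable (position (d := d)) := by
  have h := (measurableEmbedding_coe (d := d)).measurable_extend measurable_id
    (measurable_const (a := (0 : EuclideanSpace ℝ (Fin d))))
  convert h using 1
  funext p
  induction p using OnePoint.rec with
  | infty =>
    rw [Function.extend_apply']
    · rfl
    · rintro ⟨x, hx⟩
      exact OnePoint.coe_ne_infty x hx
  | coe x =>
    rw [measurableEmbedding_coe.injective.extend_apply]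
    rfl

theorem continuous_extendZero (u : C₀(EuclideanSpace ℝ (Fin d), ℝ)) :
    Continuous (extendZero (u : EuclideanSpace ℝ (Fin d) → ℝ)) := by
  rw [OnePoint.continuous_iff]
  refine ⟨?_, u.continuous⟩
  rw [coclosedCompact_eq_cocompact]
  exact u.zero_at_infty'

theorem abs_apply_le_norm (u : C₀(EuclideanSpace ℝ (Fin d), ℝ)) (x : EuclideanSpace ℝ (Fin d)) :
    |u x| ≤ ‖u‖ := by
  rw [← ZeroAtInftyContinuousMap.norm_toBCF_eq_norm]
  exact u.toBCF.norm_coe_le_norm x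

theorem abs_extendZero_le_norm (u : C₀(EuclideanSpace ℝ (Fin d), ℝ)) (p : Compactified d) :
    |extendZero u p| ≤ ‖u‖ := by
  induction p using OnePoint.rec with
  | infty => simp
  | coe x => exact abs_apply_le_norm u x

theorem norm_le_of_abs_apply_le {u : C₀(EuclideanSpace ℝ (Fin d), ℝ)} {C : ℝ} (hC : 0 ≤ C)
    (h : ∀ x, |u x| ≤ C) : ‖u‖ ≤ C := by
  rw [← ZeroAtInftyContinuousMap.norm_toBCF_eq_norm]
  exact (BoundedContinuousFunction.norm_le hC).2 h

/-! ### The Feller semigroup and Dynkin's formula. -/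

namespace FellerProcess

variable {Ω : Type*} [mΩ : MeasurableSpace Ω] (𝕏 : FellerProcess d Ω)

instance (x : EuclideanSpace ℝ (Fin d)) : IsProbabilityMeasure (𝕏.P x) :=
  𝕏.isProbabilityMeasure x

theorem measurable_X (t : ℝ≥0) : Measurable (𝕏.X t) :=
  (𝕏.adapted t).mono (𝕏.ℱ.le t) le_rfl

theorem integrable_extendZero (t : ℝ≥0) (u : C₀(EuclideanSpace ℝ (Fin d), ℝ))
    (x : EuclideanSpace ℝ (Fin d)) :
    Integrable (fun ω => extendZero u (𝕏.X t ω)) (𝕏.P x) :=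
  Integrable.of_bound
    (((measurable_extendZero u.continuous.measurable).comp (𝕏.measurable_X t)).aestronglyMeasurable)
    ‖u‖ (ae_of_all _ fun _ => abs_extendZero_le_norm u _)

theorem coe_semigroup (t : ℝ≥0) (u : C₀(EuclideanSpace ℝ (Fin d), ℝ)) :
    (𝕏.semigroup t u : EuclideanSpace ℝ (Fin d) → ℝ) = transition 𝕏.X 𝕏.P t u :=
  funext fun x => 𝕏.semigroup_apply t u x

theorem semigroup_add (s t : ℝ≥0) (u : C₀(EuclideanSpace ℝ (Fin d), ℝ)) :
    𝕏.semigroup (s + t) u = 𝕏.semigroup s (𝕏.semigroup t u) := by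
  ext x
  rw [semigroup_apply, semigroup_apply, coe_semigroup,
    ← integral_condExp (𝕏.ℱ.le s) (f := fun ω => extendZero u (𝕏.X (s + t) ω))]
  exact integral_congr_ae (𝕏.markov x s t u u.continuous.measurable ⟨‖u‖, abs_apply_le_norm u⟩)

theorem semigroup_zero (u : C₀(EuclideanSpace ℝ (Fin d), ℝ)) : 𝕏.semigroup 0 u = u := by
  ext x
  rw [semigroup_apply]
  have : (fun ω => extendZero u (𝕏.X 0 ω)) =ᵐ[𝕏.P x] fun _ => u x := by
    filter_upwards [𝕏.start x] with ω h
    rw [h, extendZero_coe]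
  rw [integral_congr_ae this]
  simp

theorem abs_semigroup_apply_le (t : ℝ≥0) (u : C₀(EuclideanSpace ℝ (Fin d), ℝ))
    (x : EuclideanSpace ℝ (Fin d)) : |𝕏.semigroup t u x| ≤ ‖u‖ := by
  rw [semigroup_apply]
  have := norm_integral_le_of_norm_le_const (μ := 𝕏.P x)
    (f := fun ω => extendZero u (𝕏.X t ω)) (C := ‖u‖) (ae_of_all _ fun ω => abs_extendZero_le_norm u (𝕏.X t ω))
  simpa using this

theorem semigroup_sub (t : ℝ≥0) (u v : C₀(EuclideanSpace ℝ (Fin d), ℝ)) :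
    𝕏.semigroup t (u - v) = 𝕏.semigroup t u - 𝕏.semigroup t v := by
  ext x
  rw [ZeroAtInftyContinuousMap.sub_apply]
  simp only [semigroup_apply]
  rw [← integral_sub (𝕏.integrable_extendZero t u x) (𝕏.integrable_extendZero t v x)]
  exact integral_congr_ae (ae_of_all _ fun _ => extendZero_sub u v _)

theorem semigroup_smul (t : ℝ≥0) (c : ℝ) (u : C₀(EuclideanSpace ℝ (Fin d), ℝ)) :
    𝕏.semigroup t (c • u) = c • 𝕏.semigroup t u := by
  ext x
  rw [ZeroAtInftyContinuousMap.smul_apply]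
  simp only [semigroup_apply]
  rw [← integral_smul]
  exact integral_congr_ae (ae_of_all _ fun _ => extendZero_smul c u _)

theorem norm_semigroup_le (t : ℝ≥0) (u : C₀(EuclideanSpace ℝ (Fin d), ℝ)) :
    ‖𝕏.semigroup t u‖ ≤ ‖u‖ :=
  norm_le_of_abs_apply_le (norm_nonneg u) (𝕏.abs_semigroup_apply_le t u)

theorem tendsto_semigroup_zero (u : C₀(EuclideanSpace ℝ (Fin d), ℝ)) :
    Tendsto (fun t => 𝕏.semigroup t u) (𝓝 0) (𝓝 u) := by
  have h : Tendsto (fun t => 𝕏.semigroup t u) (𝓝[>] 0) (𝓝 u) := by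
    rw [ZeroAtInftyContinuousMap.tendsto_iff_tendstoUniformly]
    simpa only [coe_semigroup] using 𝕏.strongly_continuous u
  -- Since $0$ is the least element of `ℝ≥0`, a full neighbourhood of $0$ is a right neighbourhood
  -- together with the point.
  have h0 : (𝓝 (0 : ℝ≥0)) = 𝓝[>] 0 ⊔ pure 0 := by
    rw [← nhdsNE_sup_pure]
    congr 2
    ext x
    simp [pos_iff_ne_zero]
  rw [h0, tendsto_sup]
  refine ⟨h, ?_⟩
  rw [tendsto_pure_left]
  intro s hs
  rw [semigroup_zero]
  exact mem_of_mem_nhds hs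

/-- The semigroup law and contractivity carry the modulus of continuity at time $0$ to all times. -/
theorem dist_semigroup_le (s t : ℝ≥0) (u : C₀(EuclideanSpace ℝ (Fin d), ℝ)) :
    dist (𝕏.semigroup s u) (𝕏.semigroup t u) ≤ ‖𝕏.semigroup (nndist s t) u - u‖ := by
  wlog h : s ≤ t generalizing s t
  · rw [dist_comm, nndist_comm]
    exact this t s (le_of_not_ge h)
  obtain ⟨r, rfl⟩ := exists_add_of_le h
  have hr : nndist s (s + r) = r := by
    apply NNReal.coe_injective
    simp [NNReal.dist_eq]
  rw [hr, dist_comm, dist_eq_norm, semigroup_add, ← semigroup_sub]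
  exact 𝕏.norm_semigroup_le _ _

theorem continuous_semigroup (u : C₀(EuclideanSpace ℝ (Fin d), ℝ)) :
    Continuous fun t => 𝕏.semigroup t u := by
  rw [continuous_iff_continuousAt]
  intro t
  rw [ContinuousAt, tendsto_iff_dist_tendsto_zero]
  refine squeeze_zero (fun _ => dist_nonneg) (fun s => 𝕏.dist_semigroup_le s t u) ?_
  have h1 : Tendsto (fun s : ℝ≥0 => nndist s t) (𝓝 t) (𝓝 0) := by
    have : Continuous fun s : ℝ≥0 => nndist s t := by fun_prop
    simpa using this.tendsto t
  have h2 := ((𝕏.tendsto_semigroup_zero u).comp h1).sub_const u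
  simpa using h2.norm

theorem continuous_semigroup_apply (u : C₀(EuclideanSpace ℝ (Fin d), ℝ))
    (x : EuclideanSpace ℝ (Fin d)) :
    Continuous fun r : ℝ => 𝕏.semigroup r.toNNReal u x := by
  have h : Continuous fun v : C₀(EuclideanSpace ℝ (Fin d), ℝ) => v x := by
    have : LipschitzWith 1 fun v : C₀(EuclideanSpace ℝ (Fin d), ℝ) => v x := by
      refine LipschitzWith.of_dist_le_mul fun v w => ?_
      rw [dist_eq_norm, dist_eq_norm, NNReal.coe_one, one_mul]
      exact abs_apply_le_norm (v - w) x
    exact this.continuous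
  exact h.comp ((𝕏.continuous_semigroup u).comp continuous_real_toNNReal)

/-- The difference quotient at $t$ is $T_t$ applied to the one at $0$, and $T_t$ is a contraction. A
right derivative is enough both for the fundamental theorem of calculus and for Gronwall's lemma. -/
theorem hasDerivWithinAt_semigroup_apply {u v : C₀(EuclideanSpace ℝ (Fin d), ℝ)}
    (h : 𝕏.HasGenerator u v) (x : EuclideanSpace ℝ (Fin d)) {t : ℝ} (ht : 0 ≤ t) :
    HasDerivWithinAt (fun r : ℝ => 𝕏.semigroup r.toNNReal u x) (𝕏.semigroup t.toNNReal v x)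
      (Set.Ici t) t := by
  rw [← hasDerivWithinAt_Ioi_iff_Ici, hasDerivWithinAt_iff_tendsto_slope' (by simp),
    tendsto_iff_dist_tendsto_zero]
  have hr : Tendsto (fun r : ℝ => (r - t).toNNReal) (𝓝[>] t) (𝓝[>] 0) := by
    refine tendsto_nhdsWithin_iff.2 ⟨?_, ?_⟩
    · have : Continuous fun r : ℝ => (r - t).toNNReal := by fun_prop
      simpa using (this.tendsto t).mono_left nhdsWithin_le_nhds
    · filter_upwards [self_mem_nhdsWithin] with r hr
      simpa using hr
  have h1 := tendsto_iff_dist_tendsto_zero.1 (h.comp hr)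
  refine squeeze_zero' (Eventually.of_forall fun _ => dist_nonneg) ?_ h1
  filter_upwards [self_mem_nhdsWithin] with r hr
  have hr : t < r := hr
  have e : r.toNNReal = t.toNNReal + (r - t).toNNReal := by
    rw [← Real.toNNReal_add ht (by linarith)]
    ring_nf
  have e2 : ((r - t).toNNReal : ℝ) = r - t := Real.coe_toNNReal _ (by linarith)
  have : slope (fun r : ℝ => 𝕏.semigroup r.toNNReal u x) t r - 𝕏.semigroup t.toNNReal v x =
      𝕏.semigroup t.toNNReal
        (((r - t).toNNReal : ℝ)⁻¹ • (𝕏.semigroup (r - t).toNNReal u - u) - v) x := by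
    rw [semigroup_sub, semigroup_smul, semigroup_sub, ← semigroup_add, ← e, slope_def_field, e2]
    simp only [ZeroAtInftyContinuousMap.sub_apply, ZeroAtInftyContinuousMap.smul_apply,
      smul_eq_mul]
    ring
  rw [Real.dist_eq, this, Function.comp_apply, dist_eq_norm]
  exact 𝕏.abs_semigroup_apply_le _ _ _

/-- Dynkin's formula. -/
theorem integral_semigroup_generator {u v : C₀(EuclideanSpace ℝ (Fin d), ℝ)}
    (h : 𝕏.HasGenerator u v) (x : EuclideanSpace ℝ (Fin d)) (t : ℝ≥0) :
    ∫ s in (0 : ℝ)..t, 𝕏.semigroup s.toNNReal v x = 𝕏.semigroup t u x - u x := by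
  rw [intervalIntegral.integral_eq_sub_of_hasDeriv_right
    (𝕏.continuous_semigroup_apply u x).continuousOn _
    ((𝕏.continuous_semigroup_apply v x).intervalIntegrable _ _)]
  · simp [semigroup_zero]
  · intro s hs
    refine (𝕏.hasDerivWithinAt_semigroup_apply h x ?_).mono Set.Ioi_subset_Ici_self
    simpa using hs.1.le

theorem hasGenerator_generator {u : C₀(EuclideanSpace ℝ (Fin d), ℝ)}
    (h : u ∈ 𝕏.generatorDomain) : 𝕏.HasGenerator u (𝕏.generator u) := by
  have h' : ∃ v, 𝕏.HasGenerator u v := h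
  rw [generator, dif_pos h']
  exact Classical.choose_spec h'

end FellerProcess

/-! ### Taylor and gradient bounds. -/

theorem exists_taylor_bound {φ : EuclideanSpace ℝ (Fin d) → ℝ}
    (hφ : ContDiff ℝ ((⊤ : ℕ∞) : WithTop ℕ∞) φ) (hc : HasCompactSupport φ) :
    ∃ K : ℝ, 0 ≤ K ∧ ∀ x z, |φ (x + z) - φ x - fderiv ℝ φ x z| ≤ K * ‖z‖ ^ 2 := by
  obtain ⟨K, hK⟩ := ContDiff.lipschitzWith_of_hasCompactSupport (𝕂 := ℝ) (hc.fderiv ℝ)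
    (hφ.fderiv_right (m := 1) (WithTop.coe_le_coe.2 le_top)) one_ne_zero
  refine ⟨K, K.2, fun x z => ?_⟩
  have h := (convex_closedBall x ‖z‖).norm_image_sub_le_of_norm_fderiv_le' (𝕜 := ℝ) (f := φ)
    (φ := fderiv ℝ φ x) (C := K * ‖z‖) (x := x) (y := x + z)
    (fun y _ => (hφ.differentiable (by simp)).differentiableAt) ?_ (by simp) (by simp)
  · rw [add_sub_cancel_left, Real.norm_eq_abs] at h
    rwa [mul_assoc, ← pow_two] at h
  · intro y hy
    rw [← dist_eq_norm]
    refine (hK.dist_le_mul y x).trans ?_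
    gcongr
    simpa using hy

theorem exists_fderiv_bound {φ : EuclideanSpace ℝ (Fin d) → ℝ}
    (hφ : ContDiff ℝ ((⊤ : ℕ∞) : WithTop ℕ∞) φ) (hc : HasCompactSupport φ) :
    ∃ K : ℝ, 0 ≤ K ∧ ∀ x, ‖fderiv ℝ φ x‖ ≤ K := by
  obtain ⟨C, hC⟩ := (hc.fderiv ℝ).exists_bound_of_continuous (hφ.continuous_fderiv (by simp))
  exact ⟨C, (norm_nonneg _).trans (hC 0), hC⟩

/-- A nonnegative function with a quadratic Taylor bound has its squared derivative bounded by the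
function. -/
theorem norm_fderiv_sq_le {u : EuclideanSpace ℝ (Fin d) → ℝ} {K : ℝ} (hK : 0 < K)
    (h0 : ∀ x, 0 ≤ u x) (h : ∀ x z, |u (x + z) - u x - fderiv ℝ u x z| ≤ K * ‖z‖ ^ 2)
    (x : EuclideanSpace ℝ (Fin d)) : ‖fderiv ℝ u x‖ ^ 2 ≤ 4 * K * u x := by
  have hg : ‖gradient u x‖ = ‖fderiv ℝ u x‖ := LinearIsometryEquiv.norm_map _ _
  -- The step $z=-\nabla u(x)/(2K)$ minimises the quadratic upper bound for $u(x+z)$, giving $0\le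
  -- u(x+z)\le u(x)-|\nabla u(x)|^2/(4K)$.
  have h1 := (abs_le.1 (h x (-(2 * K)⁻¹ • gradient u x))).2
  have h2 := h0 (x + -(2 * K)⁻¹ • gradient u x)
  rw [← inner_gradient_left, inner_smul_right, real_inner_self_eq_norm_sq, hg, norm_smul, hg,
    Real.norm_eq_abs, abs_neg, mul_pow, sq_abs] at h1
  have h3 : K * ((2 * K)⁻¹ ^ 2 * ‖fderiv ℝ u x‖ ^ 2) = (4 * K)⁻¹ * ‖fderiv ℝ u x‖ ^ 2 := by
    field_simp
    ring
  have h4 : (2 * K)⁻¹ * ‖fderiv ℝ u x‖ ^ 2 = 2 * ((4 * K)⁻¹ * ‖fderiv ℝ u x‖ ^ 2) := by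
    field_simp
    ring
  have h5 : (4 * K)⁻¹ * ‖fderiv ℝ u x‖ ^ 2 ≤ u x := by
    linarith
  rw [inv_mul_le_iff₀ (by positivity)] at h5
  exact h5

/-! ### The jump operator under a second moment bound. -/

section JumpKernel

/-- The measures `N x` have second moments bounded by `M`. -/
def SecondMomentBound (N : EuclideanSpace ℝ (Fin d) → Measure (EuclideanSpace ℝ (Fin d)))
    (M : ℝ) : Prop :=
  ∀ x, Integrable (fun z => ‖z‖ ^ 2) ((N x).restrict {0}ᶜ) ∧
    ∫ z in {0}ᶜ, ‖z‖ ^ 2 ∂(N x) ≤ M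

theorem exists_secondMomentBound
    {N : EuclideanSpace ℝ (Fin d) → Measure (EuclideanSpace ℝ (Fin d))}
    (h : (⨆ x : EuclideanSpace ℝ (Fin d), ∫⁻ z in {0}ᶜ, ‖z‖ₑ ^ 2 ∂(N x)) < (⊤ : ℝ≥0∞)) :
    ∃ M, 0 ≤ M ∧ SecondMomentBound N M := by
  refine ⟨(⨆ x : EuclideanSpace ℝ (Fin d), ∫⁻ z in {0}ᶜ, ‖z‖ₑ ^ 2 ∂(N x)).toReal,
    ENNReal.toReal_nonneg, fun x => ?_⟩
  have hx := le_iSup (fun x : EuclideanSpace ℝ (Fin d) => ∫⁻ z in {0}ᶜ, ‖z‖ₑ ^ 2 ∂(N x)) x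
  have e : ∀ z : EuclideanSpace ℝ (Fin d), ‖‖z‖ ^ 2‖ₑ = ‖z‖ₑ ^ 2 := fun z => by
    rw [enorm_pow, enorm_norm]
  have hm : AEStronglyMeasurable (fun z : EuclideanSpace ℝ (Fin d) => ‖z‖ ^ 2)
      ((N x).restrict {0}ᶜ) := by fun_prop
  refine ⟨⟨hm, ?_⟩, ?_⟩
  · rw [hasFiniteIntegral_iff_enorm]
    simp only [e]
    exact hx.trans_lt h
  · rw [integral_eq_lintegral_of_nonneg_ae (ae_of_all _ fun z => by positivity) hm]
    refine ENNReal.toReal_mono h.ne (le_trans (le_of_eq ?_) hx)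
    refine lintegral_congr fun z => ?_
    rw [← e, Real.enorm_of_nonneg (by positivity)]

variable {N : EuclideanSpace ℝ (Fin d) → Measure (EuclideanSpace ℝ (Fin d))} {M : ℝ}

/-- The integrand of the jump operator. -/
def jumpIntegrand (u : EuclideanSpace ℝ (Fin d) → ℝ) (x z : EuclideanSpace ℝ (Fin d)) : ℝ :=
  u (x + z) - u x - Set.indicator {z | ‖z‖ < 1} (fun z => (inner ℝ (gradient u x) z : ℝ)) z

theorem jumpIntegrand_of_lt (u : EuclideanSpace ℝ (Fin d) → ℝ) (x : EuclideanSpace ℝ (Fin d))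
    {z : EuclideanSpace ℝ (Fin d)} (hz : ‖z‖ < 1) :
    jumpIntegrand u x z = u (x + z) - u x - fderiv ℝ u x z := by
  rw [jumpIntegrand, Set.indicator_of_mem (by exact hz), inner_gradient_left]

theorem jumpIntegrand_of_le (u : EuclideanSpace ℝ (Fin d) → ℝ) (x : EuclideanSpace ℝ (Fin d))
    {z : EuclideanSpace ℝ (Fin d)} (hz : 1 ≤ ‖z‖) :
    jumpIntegrand u x z = u (x + z) - u x := by
  rw [jumpIntegrand, Set.indicator_of_notMem (by simpa using hz), sub_zero]

theorem aestronglyMeasurable_jumpIntegrand {u : EuclideanSpace ℝ (Fin d) → ℝ} (hu : Continuous u)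
    (x : EuclideanSpace ℝ (Fin d)) (μ : Measure (EuclideanSpace ℝ (Fin d))) :
    AEStronglyMeasurable (jumpIntegrand u x) μ := by
  have h : Measurable (Set.indicator {z : EuclideanSpace ℝ (Fin d) | ‖z‖ < 1}
      (fun z => (inner ℝ (gradient u x) z : ℝ))) :=
    Measurable.indicator (by fun_prop) (measurableSet_lt measurable_norm measurable_const)
  have h' : Measurable fun z => u (x + z) - u x :=
    (Continuous.sub (by fun_prop) continuous_const).measurable
  exact (h'.sub h).aestronglyMeasurable

/-- Where $|z|\ge1$ the compensator is absent; the missing gradient term costs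
$\|Du(x)\||z|\le\|Du(x)\||z|^2$. -/
theorem abs_jumpIntegrand_le {u : EuclideanSpace ℝ (Fin d) → ℝ} {K : ℝ}
    {x : EuclideanSpace ℝ (Fin d)}
    (h : ∀ z, |u (x + z) - u x - fderiv ℝ u x z| ≤ K * ‖z‖ ^ 2) (z : EuclideanSpace ℝ (Fin d)) :
    |jumpIntegrand u x z| ≤ (K + ‖fderiv ℝ u x‖) * ‖z‖ ^ 2 := by
  rw [add_mul]
  rcases lt_or_ge ‖z‖ 1 with hz | hz
  · rw [jumpIntegrand_of_lt u x hz]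
    exact (h z).trans (le_add_of_nonneg_right (by positivity))
  · rw [jumpIntegrand_of_le u x hz]
    have h1 : |fderiv ℝ u x z| ≤ ‖fderiv ℝ u x‖ * ‖z‖ := (fderiv ℝ u x).le_opNorm z
    have h2 : ‖fderiv ℝ u x‖ * ‖z‖ ≤ ‖fderiv ℝ u x‖ * ‖z‖ ^ 2 := by
      gcongr
      nlinarith
    calc |u (x + z) - u x| = |(u (x + z) - u x - fderiv ℝ u x z) + fderiv ℝ u x z| := by ring_nf
      _ ≤ _ := abs_add_le _ _
      _ ≤ _ := add_le_add (h z) (h1.trans h2)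

theorem SecondMomentBound.abs_jumpOperator_le (hM : SecondMomentBound N M)
    {u : EuclideanSpace ℝ (Fin d) → ℝ} {K : ℝ} (hK : 0 ≤ K)
    {x : EuclideanSpace ℝ (Fin d)}
    (h : ∀ z, |u (x + z) - u x - fderiv ℝ u x z| ≤ K * ‖z‖ ^ 2) :
    |jumpOperator N u x| ≤ (K + ‖fderiv ℝ u x‖) * M := by
  have h1 := norm_integral_le_of_norm_le (μ := (N x).restrict {0}ᶜ) (f := jumpIntegrand u x)
    ((hM x).1.const_mul (K + ‖fderiv ℝ u x‖)) (ae_of_all _ (abs_jumpIntegrand_le h))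
  rw [integral_const_mul] at h1
  refine h1.trans ?_
  gcongr
  exact (hM x).2

/-- Near $x$ and near $x+z$ the functions eventually coincide with $p$, so the integrands are
eventually constant in $n$ and the gradient in the dominating function can be taken to be that of
$p$. -/
theorem SecondMomentBound.tendsto_jumpOperator (hM : SecondMomentBound N M)
    {f : ℕ → EuclideanSpace ℝ (Fin d) → ℝ} {p : EuclideanSpace ℝ (Fin d) → ℝ} {K : ℝ}
    (hf : ∀ n, Continuous (f n))
    (hp : ∀ x, ∀ᶠ n in atTop, f n =ᶠ[𝓝 x] p)
    (x : EuclideanSpace ℝ (Fin d))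
    (h : ∀ n z, |f n (x + z) - f n x - fderiv ℝ (f n) x z| ≤ K * ‖z‖ ^ 2) :
    Tendsto (fun n => jumpOperator N (f n) x) atTop (𝓝 (jumpOperator N p x)) := by
  refine tendsto_integral_filter_of_dominated_convergence (μ := (N x).restrict {0}ᶜ)
    (F := fun n => jumpIntegrand (f n) x) (f := jumpIntegrand p x)
    (fun z => (K + ‖fderiv ℝ p x‖) * ‖z‖ ^ 2)
    (Eventually.of_forall fun n => aestronglyMeasurable_jumpIntegrand (hf n) x _) ?_
    ((hM x).1.const_mul _) (ae_of_all _ fun z => ?_)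
  · filter_upwards [hp x] with n hn
    refine ae_of_all _ fun z => ?_
    rw [← hn.fderiv_eq]
    exact abs_jumpIntegrand_le (h n) z
  · refine tendsto_const_nhds.congr' ?_
    filter_upwards [hp x, hp (x + z)] with n h1 h2
    rw [jumpIntegrand, jumpIntegrand, h1.eq_of_nhds, h2.eq_of_nhds, gradient, gradient,
      h1.fderiv_eq]

theorem SecondMomentBound.integrable_of_le (hM : SecondMomentBound N M)
    (x : EuclideanSpace ℝ (Fin d)) {g : EuclideanSpace ℝ (Fin d) → ℝ} (hg : Measurable g)
    (h : ∀ z, |g z| ≤ ‖z‖ ^ 2) : Integrable g ((N x).restrict {0}ᶜ) :=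
  (hM x).1.mono' hg.aestronglyMeasurable (ae_of_all _ h)

/-- The large-jump part of the coordinate `z i`. -/
def largePart (i : Fin d) : EuclideanSpace ℝ (Fin d) → ℝ :=
  Set.indicator {z | 1 ≤ ‖z‖} (fun z => z i)

theorem measurableSet_large : MeasurableSet {z : EuclideanSpace ℝ (Fin d) | 1 ≤ ‖z‖} :=
  measurableSet_le measurable_const measurable_norm

theorem measurable_largePart (i : Fin d) : Measurable (largePart i) :=
  Measurable.indicator (by fun_prop) measurableSet_large

theorem abs_coord_le (z : EuclideanSpace ℝ (Fin d)) (i : Fin d) : |z i| ≤ ‖z‖ :=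
  PiLp.norm_apply_le z i

theorem abs_largePart_le (i : Fin d) (z : EuclideanSpace ℝ (Fin d)) :
    |largePart i z| ≤ ‖z‖ ^ 2 := by
  by_cases hz : 1 ≤ ‖z‖
  · rw [largePart, Set.indicator_of_mem (by exact hz)]
    have := abs_coord_le z i
    nlinarith
  · rw [largePart, Set.indicator_of_notMem (by exact hz)]
    simp only [abs_zero]
    positivity

theorem coord_sq_le (i : Fin d) (z : EuclideanSpace ℝ (Fin d)) : |z i ^ 2| ≤ ‖z‖ ^ 2 := by
  rw [abs_pow]
  gcongr
  exact abs_coord_le z i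

theorem largeJumpMean_eq (i : Fin d) (x : EuclideanSpace ℝ (Fin d)) :
    largeJumpMean N i x = ∫ z in {0}ᶜ, largePart i z ∂(N x) := by
  rw [largeJumpMean]
  unfold largePart
  rw [integral_indicator measurableSet_large, Measure.restrict_restrict measurableSet_large,
    Set.inter_eq_left.2]
  rintro z hz rfl
  have hz : (1 : ℝ) ≤ ‖(0 : EuclideanSpace ℝ (Fin d))‖ := hz
  norm_num at hz

theorem SecondMomentBound.abs_largeJumpMean_le (hM : SecondMomentBound N M) (i : Fin d)
    (x : EuclideanSpace ℝ (Fin d)) : |largeJumpMean N i x| ≤ M := by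
  rw [largeJumpMean_eq]
  exact (norm_integral_le_of_norm_le (f := largePart i) (hM x).1
    (ae_of_all _ (abs_largePart_le i))).trans (hM x).2

theorem SecondMomentBound.abs_jumpSecondMoment_le (hM : SecondMomentBound N M) (i : Fin d)
    (x : EuclideanSpace ℝ (Fin d)) : |jumpSecondMoment N i x| ≤ M :=
  (norm_integral_le_of_norm_le (f := fun z => z i ^ 2) (hM x).1
    (ae_of_all _ (coord_sq_le i))).trans (hM x).2

theorem hasFDerivAt_coord_sub_pow (i : Fin d) (x₀ x : EuclideanSpace ℝ (Fin d)) (k : ℕ) :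
    HasFDerivAt (fun y : EuclideanSpace ℝ (Fin d) => (y i - x₀ i) ^ k)
      ((k * (x i - x₀ i) ^ (k - 1)) • EuclideanSpace.proj (𝕜 := ℝ) i) x := by
  have h : HasFDerivAt (fun y : EuclideanSpace ℝ (Fin d) => y i - x₀ i)
      (EuclideanSpace.proj (𝕜 := ℝ) i) x :=
    ((EuclideanSpace.proj (𝕜 := ℝ) i).hasFDerivAt (x := x)).sub_const (x₀ i)
  simpa using h.pow k

/-- The compensator cancels the small jumps of an affine function exactly. The exponent `1` keeps
the shape common to all truncated powers. -/
theorem jumpOperator_coord (i : Fin d) (x₀ x : EuclideanSpace ℝ (Fin d)) :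
    jumpOperator N (fun y => (y i - x₀ i) ^ 1) x = largeJumpMean N i x := by
  rw [largeJumpMean_eq]
  refine integral_congr_ae (ae_of_all _ fun z => ?_)
  change jumpIntegrand (fun y => (y i - x₀ i) ^ 1) x z = _
  rcases lt_or_ge ‖z‖ 1 with hz | hz
  · rw [jumpIntegrand_of_lt _ x hz, (hasFDerivAt_coord_sub_pow i x₀ x 1).fderiv, largePart,
      Set.indicator_of_notMem (by simpa using hz)]
    simp
  · rw [jumpIntegrand_of_le _ x hz, largePart, Set.indicator_of_mem (by exact hz)]
    simp

/-- The increment of $a^2$ is $z_i^2+2az_i$ with $a=x_i-x_{0,i}$; the compensator removes the cross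
term only for $|z|<1$. -/
theorem SecondMomentBound.jumpOperator_coord_sq (hM : SecondMomentBound N M) (i : Fin d)
    (x₀ x : EuclideanSpace ℝ (Fin d)) :
    jumpOperator N (fun y => (y i - x₀ i) ^ 2) x =
      jumpSecondMoment N i x + 2 * ((x i - x₀ i) * largeJumpMean N i x) := by
  rw [largeJumpMean_eq, jumpSecondMoment, ← integral_const_mul, ← integral_const_mul,
    ← integral_add (hM.integrable_of_le x (by fun_prop) (coord_sq_le i))
    (((hM.integrable_of_le x (measurable_largePart i) (abs_largePart_le i)).const_mul _).const_mul
      _)]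
  refine integral_congr_ae (ae_of_all _ fun z => ?_)
  change jumpIntegrand (fun y => (y i - x₀ i) ^ 2) x z = _
  rcases lt_or_ge ‖z‖ 1 with hz | hz
  · rw [jumpIntegrand_of_lt _ x hz, (hasFDerivAt_coord_sub_pow i x₀ x 2).fderiv]
    have h : largePart i z = 0 := Set.indicator_of_notMem (by simpa using hz) _
    simp [h]
    ring
  · rw [jumpIntegrand_of_le _ x hz]
    have h : largePart i z = z i := Set.indicator_of_mem (by exact hz) _
    simp [h]
    ring

end JumpKernel

/-! ### Truncated powers of a coordinate. -/

section TestFunctions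

/-- A smooth cutoff function, equal to `1` on the unit ball. -/
def cutoff (d : ℕ) : ContDiffBump (0 : EuclideanSpace ℝ (Fin d)) where
  rIn := 1
  rOut := 2
  rIn_pos := one_pos
  rIn_lt_rOut := one_lt_two

/-- The function `(y i - x₀ i) ^ k`, smoothly cut off outside a ball of radius `n + 1`. -/
def testFun (i : Fin d) (k : ℕ) (x₀ : EuclideanSpace ℝ (Fin d)) (n : ℕ)
    (y : EuclideanSpace ℝ (Fin d)) : ℝ :=
  (y i - x₀ i) ^ k * cutoff d (((n : ℝ) + 1)⁻¹ • (y - x₀))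

variable (i : Fin d) (k : ℕ) (x₀ : EuclideanSpace ℝ (Fin d)) (n : ℕ)

theorem contDiff_testFun : ContDiff ℝ ((⊤ : ℕ∞) : WithTop ℕ∞) (testFun i k x₀ n) := by
  have h1 : ContDiff ℝ ((⊤ : ℕ∞) : WithTop ℕ∞) fun y : EuclideanSpace ℝ (Fin d) => y i :=
    (EuclideanSpace.proj (𝕜 := ℝ) i).contDiff
  have h2 : ContDiff ℝ ((⊤ : ℕ∞) : WithTop ℕ∞) fun y : EuclideanSpace ℝ (Fin d) =>
      ((n : ℝ) + 1)⁻¹ • (y - x₀) := by fun_prop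
  exact ((h1.sub contDiff_const).pow k).mul ((cutoff d).contDiff.comp h2)

theorem hasCompactSupport_testFun : HasCompactSupport (testFun i k x₀ n) := by
  refine HasCompactSupport.intro (isCompact_closedBall x₀ (2 * ((n : ℝ) + 1))) fun y hy => ?_
  rw [testFun, (cutoff d).zero_of_le_dist, mul_zero]
  rw [Metric.mem_closedBall, not_le, dist_eq_norm] at hy
  rw [dist_zero_right, norm_smul, norm_inv, Real.norm_of_nonneg (by positivity)]
  show (2 : ℝ) ≤ _
  rw [le_inv_mul_iff₀ (by positivity)]
  linarith

/-- Equality of germs, not only of values, so that gradients agree as well. -/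
theorem eventually_testFun_eventuallyEq (x : EuclideanSpace ℝ (Fin d)) :
    ∀ᶠ n in atTop, testFun i k x₀ n =ᶠ[𝓝 x] fun y => (y i - x₀ i) ^ k := by
  obtain ⟨m, hm⟩ := exists_nat_gt ‖x - x₀‖
  filter_upwards [eventually_ge_atTop m] with n hn
  have hc : Continuous fun y : EuclideanSpace ℝ (Fin d) => ‖y - x₀‖ := by fun_prop
  filter_upwards [(hc.tendsto x).eventually (gt_mem_nhds hm)] with y hy
  rw [testFun, (cutoff d).one_of_mem_closedBall, mul_one]
  rw [mem_closedBall_zero_iff, norm_smul, norm_inv, Real.norm_of_nonneg (by positivity)]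
  show _ ≤ (1 : ℝ)
  rw [inv_mul_le_iff₀ (by positivity)]
  have : (m : ℝ) ≤ n := by exact_mod_cast hn
  linarith

/-- Homogeneity of the power reduces every estimate to $x_0=0$, $n=0$, so the constants do not
depend on $x_0$ or $n$. -/
theorem testFun_eq_scale (y : EuclideanSpace ℝ (Fin d)) :
    testFun i k x₀ n y =
      ((n : ℝ) + 1) ^ k * testFun i k 0 0 (((n : ℝ) + 1)⁻¹ • (y - x₀)) := by
  simp only [testFun, PiLp.smul_apply, PiLp.sub_apply, PiLp.zero_apply, smul_eq_mul, sub_zero,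
    Nat.cast_zero, zero_add, inv_one, one_smul]
  rw [← mul_assoc, ← mul_pow, mul_inv_cancel_left₀ (by positivity)]

theorem fderiv_testFun (x z : EuclideanSpace ℝ (Fin d)) :
    fderiv ℝ (testFun i k x₀ n) x z = ((n : ℝ) + 1) ^ k *
      fderiv ℝ (testFun i k 0 0) (((n : ℝ) + 1)⁻¹ • (x - x₀)) (((n : ℝ) + 1)⁻¹ • z) := by
  have h1 : HasFDerivAt (fun y : EuclideanSpace ℝ (Fin d) => ((n : ℝ) + 1)⁻¹ • (y - x₀))
      (((n : ℝ) + 1)⁻¹ • ContinuousLinearMap.id ℝ _) x :=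
    ((hasFDerivAt_id x).sub_const x₀).const_smul (((n : ℝ) + 1)⁻¹)
  have h2 := ((((contDiff_testFun i k 0 0).differentiable (by simp)).differentiableAt.hasFDerivAt
    (x := ((n : ℝ) + 1)⁻¹ • (x - x₀))).comp x h1).const_mul (((n : ℝ) + 1) ^ k)
  have h3 : testFun i k x₀ n = fun y => ((n : ℝ) + 1) ^ k *
      (testFun i k 0 0 ∘ fun y => ((n : ℝ) + 1)⁻¹ • (y - x₀)) y :=
    funext fun y => testFun_eq_scale i k x₀ n y
  rw [h3, h2.fderiv]
  simp

theorem exists_testFun_taylor_bound : ∃ K : ℝ, 0 < K ∧ ∀ x₀ n x z,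
    |testFun i k x₀ n (x + z) - testFun i k x₀ n x - fderiv ℝ (testFun i k x₀ n) x z| ≤
      ((n : ℝ) + 1) ^ k * (K * (((n : ℝ) + 1)⁻¹ * ‖z‖) ^ 2) := by
  obtain ⟨K, hK0, hK⟩ := exists_taylor_bound (contDiff_testFun i k 0 0)
    (hasCompactSupport_testFun i k 0 0)
  -- Adding $1$ makes the constant strictly positive, as division by it in `norm_fderiv_sq_le`
  -- requires.
  refine ⟨K + 1, by positivity, fun x₀ n x z => ?_⟩
  rw [fderiv_testFun, testFun_eq_scale, testFun_eq_scale i k x₀ n x, ← mul_sub, ← mul_sub, abs_mul,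
    abs_of_nonneg (by positivity), add_sub_right_comm, smul_add]
  gcongr
  refine (hK _ _).trans ?_
  rw [norm_smul, norm_inv, Real.norm_of_nonneg (by positivity)]
  gcongr
  linarith

theorem exists_testFun_taylor_bound_of_le_two (hk : k ≤ 2) : ∃ K : ℝ, 0 < K ∧ ∀ x₀ n x z,
    |testFun i k x₀ n (x + z) - testFun i k x₀ n x - fderiv ℝ (testFun i k x₀ n) x z| ≤
      K * ‖z‖ ^ 2 := by
  obtain ⟨K, hK0, hK⟩ := exists_testFun_taylor_bound i k
  refine ⟨K, hK0, fun x₀ n x z => (hK x₀ n x z).trans ?_⟩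
  have h1 : ((n : ℝ) + 1) ^ k ≤ ((n : ℝ) + 1) ^ 2 := pow_le_pow_right₀ (by simp) hk
  calc ((n : ℝ) + 1) ^ k * (K * (((n : ℝ) + 1)⁻¹ * ‖z‖) ^ 2)
      ≤ ((n : ℝ) + 1) ^ 2 * (K * (((n : ℝ) + 1)⁻¹ * ‖z‖) ^ 2) := by gcongr
    _ = K * ‖z‖ ^ 2 := by field_simp

theorem exists_testFun_fderiv_bound : ∃ K : ℝ, 0 ≤ K ∧ ∀ x₀ n x,
    ‖fderiv ℝ (testFun i k x₀ n) x‖ ≤ ((n : ℝ) + 1) ^ k * (K * ((n : ℝ) + 1)⁻¹) := by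
  obtain ⟨K, hK0, hK⟩ := exists_fderiv_bound (contDiff_testFun i k 0 0)
    (hasCompactSupport_testFun i k 0 0)
  refine ⟨K, hK0, fun x₀ n x => ContinuousLinearMap.opNorm_le_bound _ (by positivity) fun z => ?_⟩
  rw [fderiv_testFun, norm_mul, Real.norm_of_nonneg (by positivity), mul_assoc, mul_assoc]
  gcongr
  refine (ContinuousLinearMap.le_opNorm _ _).trans ?_
  rw [norm_smul, norm_inv, Real.norm_of_nonneg (by positivity)]
  gcongr
  exact hK _

theorem abs_testFun_le (y : EuclideanSpace ℝ (Fin d)) :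
    |testFun i k x₀ n y| ≤ |y i - x₀ i| ^ k := by
  rw [testFun, abs_mul, abs_pow, abs_of_nonneg (cutoff d).nonneg]
  exact mul_le_of_le_one_right (by positivity) (cutoff d).le_one

theorem testFun_nonneg_of_even (hk : Even k) (y : EuclideanSpace ℝ (Fin d)) :
    0 ≤ testFun i k x₀ n y :=
  mul_nonneg (hk.pow_nonneg _) (cutoff d).nonneg

/-- The test function as an element of `C₀`. -/
def testC₀ : C₀(EuclideanSpace ℝ (Fin d), ℝ) where
  toFun := testFun i k x₀ n
  continuous_toFun := (contDiff_testFun i k x₀ n).continuous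
  zero_at_infty' := (hasCompactSupport_testFun i k x₀ n).is_zero_at_infty

@[simp] theorem coe_testC₀ : (testC₀ i k x₀ n : EuclideanSpace ℝ (Fin d) → ℝ) = testFun i k x₀ n :=
  rfl

end TestFunctions

/-! ### Limits of truncations, measurability and Fatou's lemma on the compactification. -/

theorem tendsto_extendZero_testFun (i : Fin d) (k : ℕ) (x₀ : EuclideanSpace ℝ (Fin d))
    (p : Compactified d) :
    Tendsto (fun n => extendZero (testFun i k x₀ n) p) atTop
      (𝓝 (extendZero (fun y => (y i - x₀ i) ^ k) p)) := by
  induction p using OnePoint.rec with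
  | infty => simp
  | coe x =>
    refine tendsto_const_nhds.congr' ?_
    filter_upwards [eventually_testFun_eventuallyEq i k x₀ x] with n hn
    simp [hn.eq_of_nhds]

theorem extendZero_eq_of_ne_infty (u : EuclideanSpace ℝ (Fin d) → ℝ) {p : Compactified d}
    (hp : p ≠ OnePoint.infty) : extendZero u p = u (position p) := by
  obtain ⟨x, rfl⟩ := OnePoint.ne_infty_iff_exists.1 hp
  rfl

theorem ne_infty_of_extendZero_ne_zero {u : EuclideanSpace ℝ (Fin d) → ℝ} {p : Compactified d}
    (h : extendZero u p ≠ 0) : p ≠ OnePoint.infty := by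
  rintro rfl
  exact h rfl

theorem extendZero_nonneg {u : EuclideanSpace ℝ (Fin d) → ℝ} (hu : ∀ x, 0 ≤ u x)
    (p : Compactified d) : 0 ≤ extendZero u p := by
  induction p using OnePoint.rec with
  | infty => simp
  | coe x => exact hu x

theorem abs_extendZero_le {u v : EuclideanSpace ℝ (Fin d) → ℝ} (h : ∀ x, |u x| ≤ v x)
    (p : Compactified d) : |extendZero u p| ≤ extendZero v p := by
  induction p using OnePoint.rec with
  | infty => simp
  | coe x => exact h x

theorem abs_extendZero_le_one_add {u v : EuclideanSpace ℝ (Fin d) → ℝ} {C : ℝ} (hC : 0 ≤ C)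
    (h : ∀ x, |u x| ≤ C * (1 + v x)) (p : Compactified d) :
    |extendZero u p| ≤ C * (1 + extendZero v p) := by
  induction p using OnePoint.rec with
  | infty => simpa using hC
  | coe x => exact h x

section Path

variable {α : Type*} [MeasurableSpace α] {μ : Measure α} {Y : α → Compactified d}

/-- Measurability of a map into the compactification, tested against `C₀`. -/
def C₀Measurable (Y : α → Compactified d) (μ : Measure α) : Prop :=
  ∀ u : C₀(EuclideanSpace ℝ (Fin d), ℝ),
    AEStronglyMeasurable (fun a => extendZero u (Y a)) μ

theorem C₀Measurable.extendZero_pow (hY : C₀Measurable Y μ) (i : Fin d) (k : ℕ)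
    (x₀ : EuclideanSpace ℝ (Fin d)) :
    AEStronglyMeasurable (fun a => extendZero (fun y => (y i - x₀ i) ^ k) (Y a)) μ :=
  aestronglyMeasurable_of_tendsto_ae atTop (fun n => hY (testC₀ i k x₀ n))
    (ae_of_all _ fun a => tendsto_extendZero_testFun i k x₀ (Y a))

theorem C₀Measurable.position (hY : C₀Measurable Y μ) :
    AEMeasurable (fun a => position (Y a)) μ := by
  have h : AEMeasurable (fun a => (WithLp.ofLp (FellerMoment.position (Y a)) : Fin d → ℝ)) μ := by
    refine aemeasurable_pi_lambda _ fun i => ?_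
    refine (hY.extendZero_pow i 1 0).aemeasurable.congr (ae_of_all _ fun a => ?_)
    dsimp only
    induction Y a using OnePoint.rec <;> simp
  exact (MeasurableEquiv.toLp 2 (Fin d → ℝ)).measurable.comp_aemeasurable h

/-- Fatou's lemma along the truncations of the square of a coordinate. -/
theorem C₀Measurable.integrable_sq (hY : C₀Measurable Y μ) (i : Fin d)
    (x₀ : EuclideanSpace ℝ (Fin d)) {C : ℝ≥0∞} (hC : C ≠ ⊤)
    (h : ∀ n, ∫⁻ a, ENNReal.ofReal (extendZero (testFun i 2 x₀ n) (Y a)) ∂μ ≤ C) :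
    Integrable (fun a => extendZero (fun y => (y i - x₀ i) ^ 2) (Y a)) μ := by
  refine ⟨hY.extendZero_pow i 2 x₀, ?_⟩
  rw [hasFiniteIntegral_iff_ofReal
    (ae_of_all _ fun a => extendZero_nonneg (fun y => sq_nonneg _) _)]
  have h1 : ∀ a, ENNReal.ofReal (extendZero (fun y => (y i - x₀ i) ^ 2) (Y a)) =
      liminf (fun n => ENNReal.ofReal (extendZero (testFun i 2 x₀ n) (Y a))) atTop := fun a =>
    ((ENNReal.continuous_ofReal.tendsto _).comp
      (tendsto_extendZero_testFun i 2 x₀ (Y a))).liminf_eq.symm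
  simp only [h1]
  refine (lintegral_liminf_le' fun n =>
    (hY (testC₀ i 2 x₀ n)).aemeasurable.ennreal_ofReal).trans_lt ?_
  refine lt_of_le_of_lt ?_ hC.lt_top
  exact liminf_le_of_le (by isBoundedDefault) fun b hb =>
    let ⟨n, hn⟩ := hb.exists; hn.trans (h n)

end Path

/-! ### Joint measurability of the trajectory. -/

namespace FellerProcess

variable {Ω : Type*} [mΩ : MeasurableSpace Ω] (𝕏 : FellerProcess d Ω)

theorem c₀Measurable (t : ℝ≥0) (μ : Measure Ω) : C₀Measurable (𝕏.X t) μ := fun u =>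
  ((measurable_extendZero u.continuous.measurable).comp (𝕏.measurable_X t)).aestronglyMeasurable

/-- The space-time trajectory, as a function on `ℝ × Ω`. -/
def traj (q : ℝ × Ω) : Compactified d := 𝕏.X q.1.toNNReal q.2

/-- The smallest point of the grid of mesh `1 / (n + 1)` to the right of `r`. -/
def gridPoint (n : ℕ) (r : ℝ≥0) : ℝ≥0 := (⌊((n : ℝ≥0) + 1) * r⌋₊ + 1) / ((n : ℝ≥0) + 1)

theorem tendsto_gridPoint (r : ℝ≥0) :
    Tendsto (fun n => gridPoint n r) atTop (𝓝[≥] r) := by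
  have hlow : ∀ n, r ≤ gridPoint n r := fun n => by
    rw [gridPoint, le_div_iff₀ (by positivity), mul_comm]
    exact (Nat.lt_floor_add_one _).le
  have hup : ∀ n : ℕ, gridPoint n r ≤ r + 1 / ((n : ℝ≥0) + 1) := fun n => by
    rw [gridPoint, div_le_iff₀ (by positivity), add_mul r, one_div,
      inv_mul_cancel₀ (by positivity), mul_comm r]
    gcongr
    exact Nat.floor_le (by positivity)
  refine tendsto_nhdsWithin_iff.2 ⟨?_, Eventually.of_forall hlow⟩
  refine tendsto_of_tendsto_of_tendsto_of_le_of_le tendsto_const_nhds ?_ hlow hup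
  have h : Tendsto (fun n : ℕ => 1 / ((n : ℝ≥0) + 1)) atTop (𝓝 0) :=
    tendsto_one_div_add_atTop_nhds_zero_nat
  simpa using h.const_add r

/-- Sampling at grid points approaching from the right uses only countably many times, hence is
jointly measurable. Right continuity gives convergence, but only for almost every path. -/
theorem c₀Measurable_traj (μ : Measure ℝ) [SFinite μ] (x : EuclideanSpace ℝ (Fin d)) :
    C₀Measurable 𝕏.traj (μ.prod (𝕏.P x)) := by
  intro u
  refine aestronglyMeasurable_of_tendsto_ae (u := atTop)
    (f := fun n q => extendZero u (𝕏.X (gridPoint n q.1.toNNReal) q.2)) (fun n => ?_) ?_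
  · have h1 : Measurable fun p : ℕ × Ω =>
        extendZero u (𝕏.X ((p.1 + 1) / ((n : ℝ≥0) + 1)) p.2) :=
      measurable_from_prod_countable_right fun m =>
        (measurable_extendZero u.continuous.measurable).comp
          (𝕏.measurable_X (((m : ℝ≥0) + 1) / ((n : ℝ≥0) + 1)))
    have h2 : Measurable fun q : ℝ × Ω => (⌊((n : ℝ≥0) + 1) * q.1.toNNReal⌋₊, q.2) := by
      fun_prop
    exact (h1.comp h2).aestronglyMeasurable
  · have h : ∀ᵐ q ∂(μ.prod (𝕏.P x)), ∀ t : ℝ≥0,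
        ContinuousWithinAt (fun s => 𝕏.X s q.2) (Set.Ici t) t :=
      Measure.quasiMeasurePreserving_snd.ae
        ((𝕏.cadlag x).mono fun ω hω t => (hω t).1)
    filter_upwards [h] with q hq
    exact ((continuous_extendZero u).tendsto _).comp ((hq _).tendsto.comp (tendsto_gridPoint _))

/-! ### Conservativeness. -/

variable {N : EuclideanSpace ℝ (Fin d) → Measure (EuclideanSpace ℝ (Fin d))} {M : ℝ}

theorem _root_.FellerMoment.IsPureJump.hasGenerator {𝕏 : FellerProcess d Ω}
    (hN : IsPureJump 𝕏 N) (i : Fin d) (k : ℕ) (x₀ : EuclideanSpace ℝ (Fin d)) (n : ℕ) :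
    𝕏.HasGenerator (testC₀ i k x₀ n) (𝕏.generator (testC₀ i k x₀ n)) :=
  𝕏.hasGenerator_generator (hN.smooth_mem_domain (testC₀ i k x₀ n) (contDiff_testFun i k x₀ n)
    (hasCompactSupport_testFun i k x₀ n))

theorem _root_.FellerMoment.IsPureJump.generator_testC₀ {𝕏 : FellerProcess d Ω}
    (hN : IsPureJump 𝕏 N) (i : Fin d) (k : ℕ) (x₀ : EuclideanSpace ℝ (Fin d)) (n : ℕ)
    (x : EuclideanSpace ℝ (Fin d)) :
    𝕏.generator (testC₀ i k x₀ n) x = jumpOperator N (testFun i k x₀ n) x :=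
  hN.generator_eq (testC₀ i k x₀ n) (contDiff_testFun i k x₀ n) (hasCompactSupport_testFun i k x₀ n) x

/-- The generator of the cutoff functions tends to zero uniformly. -/
theorem exists_norm_generator_cutoff_le (hN : IsPureJump 𝕏 N) (i : Fin d) :
    ∃ C : ℝ, ∀ x₀ n, ‖𝕏.generator (testC₀ i 0 x₀ n)‖ ≤ C * (1 / ((n : ℝ) + 1)) := by
  obtain ⟨M, hM0, hM⟩ := exists_secondMomentBound hN.second_moment
  obtain ⟨K, hK0, hK⟩ := exists_testFun_taylor_bound i 0
  obtain ⟨G, hG0, hG⟩ := exists_testFun_fderiv_bound i 0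
  refine ⟨(K + G) * M, fun x₀ n => norm_le_of_abs_apply_le (by positivity) fun x => ?_⟩
  rw [hN.generator_testC₀]
  have hn : ((n : ℝ) + 1)⁻¹ ≤ 1 := inv_le_one_of_one_le₀ (by simp)
  have hn0 : 0 ≤ ((n : ℝ) + 1)⁻¹ := by positivity
  -- The Taylor constant is of order $(n+1)^{-2}$; it is weakened to the order $(n+1)^{-1}$ of the
  -- gradient.
  have h := hM.abs_jumpOperator_le (u := testFun i 0 x₀ n) (K := K * ((n : ℝ) + 1)⁻¹)
    (x := x) (by positivity) fun z => (hK x₀ n x z).trans ?_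
  · refine h.trans ?_
    have := hG x₀ n x
    rw [pow_zero, one_mul] at this
    calc _ ≤ (K * ((n : ℝ) + 1)⁻¹ + G * ((n : ℝ) + 1)⁻¹) * M := by gcongr
      _ = _ := by ring
  · rw [pow_zero, one_mul, mul_pow, ← mul_assoc]
    gcongr
    nlinarith

/-- For cutoffs $\chi_n\to1$ with $\chi_n(x)=1$, Dynkin's formula gives $|T_t\chi_n(x)-1|\le
Ct/(n+1)$, while $T_t\chi_n(x)\to\mathbb P_x(X_t\ne\Delta)$. -/
theorem ae_ne_infty (hN : IsPureJump 𝕏 N) (i : Fin d) (x : EuclideanSpace ℝ (Fin d)) (t : ℝ≥0) :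
    ∀ᵐ ω ∂(𝕏.P x), 𝕏.X t ω ≠ OnePoint.infty := by
  obtain ⟨C, hC⟩ := 𝕏.exists_norm_generator_cutoff_le hN i
  -- The zeroth power is identically $1$ on $\mathbb R^d$, so `g` is the indicator of
  -- $X_t\ne\Delta$.
  set g : Ω → ℝ := fun ω => extendZero (fun y => (y i - x i) ^ 0) (𝕏.X t ω) with hg
  have hg1 : ∀ ω, |g ω| ≤ 1 := fun ω => by
    rw [hg]
    dsimp only
    induction 𝕏.X t ω using OnePoint.rec <;> simp
  have hgm : AEStronglyMeasurable g (𝕏.P x) := (𝕏.c₀Measurable t _).extendZero_pow i 0 x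
  have hgi : Integrable g (𝕏.P x) := Integrable.of_bound hgm 1 (ae_of_all _ hg1)
  have hlim1 : Tendsto (fun n => 𝕏.semigroup t (testC₀ i 0 x n) x) atTop
      (𝓝 (∫ ω, g ω ∂(𝕏.P x))) := by
    simp only [semigroup_apply]
    refine tendsto_integral_of_dominated_convergence (fun _ => (1 : ℝ))
      (fun n => 𝕏.c₀Measurable t _ _) (integrable_const 1) (fun n => ae_of_all _ fun ω => ?_)
      (ae_of_all _ fun ω => tendsto_extendZero_testFun i 0 x _)
    refine (abs_extendZero_le (fun y => abs_testFun_le i 0 x n y) _).trans ?_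
    simp only [pow_zero]
    induction 𝕏.X t ω using OnePoint.rec <;> simp
  have hlim2 : Tendsto (fun n => 𝕏.semigroup t (testC₀ i 0 x n) x) atTop (𝓝 1) := by
    have h0 : Tendsto (fun n : ℕ => C * (1 / ((n : ℝ) + 1)) * |(t : ℝ) - 0|) atTop (𝓝 0) := by
      simpa using (tendsto_one_div_add_atTop_nhds_zero_nat.const_mul C).mul_const |(t : ℝ) - 0|
    rw [tendsto_iff_dist_tendsto_zero]
    refine squeeze_zero (fun _ => dist_nonneg) (fun n => ?_) h0
    have h1 : testC₀ i 0 x n x = 1 := by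
      rw [coe_testC₀, testFun, sub_self (x : EuclideanSpace ℝ (Fin d)), smul_zero,
        (cutoff d).one_of_mem_closedBall, pow_zero, one_mul]
      simpa using (cutoff d).rIn_pos.le
    have h2 := 𝕏.integral_semigroup_generator (hN.hasGenerator i 0 x n) x t
    rw [h1] at h2
    rw [Real.dist_eq, ← h2]
    exact intervalIntegral.norm_integral_le_of_norm_le_const
      (f := fun s : ℝ => 𝕏.semigroup s.toNNReal (𝕏.generator (testC₀ i 0 x n)) x)
      fun s _ => (𝕏.abs_semigroup_apply_le _ _ _).trans (hC x n)
  have hint : ∫ ω, (1 - g ω) ∂(𝕏.P x) = 0 := by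
    rw [integral_sub (integrable_const 1) hgi, tendsto_nhds_unique hlim1 hlim2]
    simp
  have hzero := (integral_eq_zero_iff_of_nonneg
    (fun ω => sub_nonneg.2 ((le_abs_self _).trans (hg1 ω))) ((integrable_const 1).sub hgi)).1 hint
  filter_upwards [hzero] with ω hω
  refine ne_infty_of_extendZero_ne_zero (u := fun y => (y i - x i) ^ 0) ?_
  have h1 : 1 - g ω = 0 := hω
  have h2 : g ω ≠ 0 := by
    intro h
    rw [h] at h1
    norm_num at h1
  exact h2

theorem ae_traj_ne_infty (hN : IsPureJump 𝕏 N) (i : Fin d) (x : EuclideanSpace ℝ (Fin d))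
    (μ : Measure ℝ) [SFinite μ] :
    ∀ᵐ q ∂(μ.prod (𝕏.P x)), 𝕏.traj q ≠ OnePoint.infty := by
  have hm : AEStronglyMeasurable
      (fun q => extendZero (fun y : EuclideanSpace ℝ (Fin d) => (y i - x i) ^ 0) (𝕏.traj q))
      (μ.prod (𝕏.P x)) :=
    (𝕏.c₀Measurable_traj μ x).extendZero_pow i 0 x
  -- The indicator of $\mathbb R^d$ along the trajectory is only a.e. measurable, so the null-slice
  -- argument is run on a measurable version of it.
  have hms : MeasurableSet {q | hm.mk _ q ≠ 1} :=
    (hm.stronglyMeasurable_mk.measurable (measurableSet_singleton 1)).compl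
  have h0 : (μ.prod (𝕏.P x)) {q | hm.mk _ q ≠ 1} = 0 := by
    refine Measure.measure_prod_null_of_ae_null hms ?_
    filter_upwards [Measure.ae_ae_of_ae_prod hm.ae_eq_mk] with s hs
    refine measure_eq_zero_iff_ae_notMem.2 ?_
    filter_upwards [hs, 𝕏.ae_ne_infty hN i x s.toNNReal] with ω h1 h2
    have h3 : extendZero (fun y => (y i - x i) ^ 0) (𝕏.traj (s, ω)) = 1 := by
      rw [extendZero_eq_of_ne_infty _ (show 𝕏.traj (s, ω) ≠ _ from h2), pow_zero]
    rw [h3] at h1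
    exact fun h => h h1.symm
  filter_upwards [hm.ae_eq_mk, measure_eq_zero_iff_ae_notMem.1 h0] with q h1 h2
  refine ne_infty_of_extendZero_ne_zero (u := fun y => (y i - x i) ^ 0) ?_
  rw [h1]
  have h3 : hm.mk _ q = 1 := not_not.1 h2
  rw [h3]
  exact one_ne_zero

/-! ### Second moments by Gronwall's lemma. -/

/-- A bound on the generator at the truncated squares by the truncated squares themselves. -/
theorem exists_generator_sq_bound (hN : IsPureJump 𝕏 N) (i : Fin d) :
    ∃ C : ℝ, 0 ≤ C ∧ ∀ x₀ n x,
      |𝕏.generator (testC₀ i 2 x₀ n) x| ≤ C * (1 + testFun i 2 x₀ n x) := by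
  obtain ⟨M, hM0, hM⟩ := exists_secondMomentBound hN.second_moment
  obtain ⟨K, hK0, hK⟩ := exists_testFun_taylor_bound_of_le_two i 2 le_rfl
  -- From $\|Du\|\le1+\|Du\|^2\le1+4Ku$ one gets $K+\|Du\|\le(5K+1)(1+u)$.
  refine ⟨(5 * K + 1) * M, by positivity, fun x₀ n x => ?_⟩
  rw [hN.generator_testC₀]
  have hu := testFun_nonneg_of_even i 2 x₀ n even_two
  have h1 := norm_fderiv_sq_le hK0 hu (hK x₀ n) x
  refine (hM.abs_jumpOperator_le hK0.le (hK x₀ n x)).trans ?_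
  rw [mul_right_comm]
  gcongr
  have h2 : ‖fderiv ℝ (testFun i 2 x₀ n) x‖ ≤ 1 + ‖fderiv ℝ (testFun i 2 x₀ n) x‖ ^ 2 := by
    nlinarith [sq_nonneg (‖fderiv ℝ (testFun i 2 x₀ n) x‖ - 1)]
  nlinarith [hu x, mul_nonneg hK0.le (hu x)]

/-- A majorant free of $n$, for dominated convergence. For $k=1$ the gradients are uniformly
bounded, so a constant suffices. -/
theorem exists_generator_bound (hN : IsPureJump 𝕏 N) (i : Fin d) {k : ℕ} (hk : k = 1 ∨ k = 2) :
    ∃ C : ℝ, 0 ≤ C ∧ ∀ x₀ n x,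
      |𝕏.generator (testC₀ i k x₀ n) x| ≤ C * (1 + (x i - x₀ i) ^ 2) := by
  rcases hk with rfl | rfl
  · obtain ⟨M, hM0, hM⟩ := exists_secondMomentBound hN.second_moment
    obtain ⟨K, hK0, hK⟩ := exists_testFun_taylor_bound_of_le_two i 1 one_le_two
    obtain ⟨G, hG0, hG⟩ := exists_testFun_fderiv_bound i 1
    refine ⟨(K + G) * M, by positivity, fun x₀ n x => ?_⟩
    rw [hN.generator_testC₀]
    have h := hG x₀ n x
    rw [pow_one, mul_left_comm, mul_inv_cancel₀ (by positivity), mul_one] at h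
    refine (hM.abs_jumpOperator_le hK0.le (hK x₀ n x)).trans ?_
    calc _ ≤ (K + G) * M := by gcongr
      _ ≤ _ := le_mul_of_one_le_right (by positivity) (by nlinarith [sq_nonneg (x i - x₀ i)])
  · obtain ⟨C, hC0, hC⟩ := 𝕏.exists_generator_sq_bound hN i
    refine ⟨C, hC0, fun x₀ n x => (hC x₀ n x).trans ?_⟩
    gcongr
    refine (le_abs_self _).trans ((abs_testFun_le i 2 x₀ n x).trans ?_)
    rw [sq_abs]

/-- The function $f(s)=T_su_n(x_0)$ has $f(0)=0$ and right derivative $T_sLu_n(x_0)$, bounded by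
$C+C|f(s)|$ with $C$ free of $n$; Gronwall's lemma applies. -/
theorem exists_semigroup_sq_bound (hN : IsPureJump 𝕏 N) (i : Fin d)
    (x₀ : EuclideanSpace ℝ (Fin d)) (t : ℝ≥0) :
    ∃ B : ℝ, ∀ n, ∀ s ∈ Set.Icc (0 : ℝ) t,
      𝕏.semigroup s.toNNReal (testC₀ i 2 x₀ n) x₀ ≤ B := by
  obtain ⟨C, hC0, hC⟩ := 𝕏.exists_generator_sq_bound hN i
  have hcont : Continuous fun s => gronwallBound 0 C C (s - 0) :=
    continuous_iff_continuousAt.2 fun s =>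
      (hasDerivAt_gronwallBound_shift 0 C C s 0).continuousAt
  obtain ⟨B, hB⟩ := (isCompact_Icc (a := (0 : ℝ)) (b := t)).bddAbove_image hcont.continuousOn
  refine ⟨B, fun n s hs => ?_⟩
  refine le_trans ?_ (hB (Set.mem_image_of_mem _ hs))
  refine (le_abs_self _).trans ?_
  refine norm_le_gronwallBound_of_norm_deriv_right_le (a := 0) (b := t)
    (f := fun r : ℝ => 𝕏.semigroup r.toNNReal (testC₀ i 2 x₀ n) x₀)
    (𝕏.continuous_semigroup_apply _ x₀).continuousOn
    (fun r hr => 𝕏.hasDerivWithinAt_semigroup_apply (hN.hasGenerator i 2 x₀ n) x₀ hr.1) ?_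
    (fun r _ => ?_) s hs
  · simp [semigroup_zero, testFun]
  · have hi := 𝕏.integrable_extendZero r.toNNReal (testC₀ i 2 x₀ n) x₀
    have e : ∫ ω, C * (1 + extendZero (testC₀ i 2 x₀ n) (𝕏.X r.toNNReal ω)) ∂(𝕏.P x₀) =
        C + C * 𝕏.semigroup r.toNNReal (testC₀ i 2 x₀ n) x₀ := by
      rw [integral_const_mul, integral_add (integrable_const 1) hi, ← semigroup_apply]
      simp [mul_add]
    have h := norm_integral_le_of_norm_le (μ := 𝕏.P x₀)
      (f := fun ω => extendZero (𝕏.generator (testC₀ i 2 x₀ n)) (𝕏.X r.toNNReal ω))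
      (((integrable_const 1).add hi).const_mul C)
      (ae_of_all _ fun ω => abs_extendZero_le_one_add hC0 (hC x₀ n) _)
    rw [← semigroup_apply] at h
    refine (h.trans_eq e).trans ?_
    rw [add_comm]
    gcongr
    exact le_abs_self _

theorem exists_lintegral_sq_bound (hN : IsPureJump 𝕏 N) (i : Fin d)
    (x₀ : EuclideanSpace ℝ (Fin d)) (t : ℝ≥0) :
    ∃ B : ℝ, ∀ n, ∀ s ∈ Set.Icc (0 : ℝ) t,
      ∫⁻ ω, ENNReal.ofReal (extendZero (testFun i 2 x₀ n) (𝕏.X s.toNNReal ω)) ∂(𝕏.P x₀) ≤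
        ENNReal.ofReal B := by
  obtain ⟨B, hB⟩ := 𝕏.exists_semigroup_sq_bound hN i x₀ t
  refine ⟨B, fun n s hs => ?_⟩
  rw [← coe_testC₀, ← ofReal_integral_eq_lintegral_ofReal
    (𝕏.integrable_extendZero s.toNNReal (testC₀ i 2 x₀ n) x₀)
    (ae_of_all _ fun ω => extendZero_nonneg (testFun_nonneg_of_even i 2 x₀ n even_two) _)]
  refine ENNReal.ofReal_le_ofReal ?_
  have := hB n s hs
  rwa [semigroup_apply] at this

theorem integrable_sq (hN : IsPureJump 𝕏 N) (i : Fin d) (x₀ : EuclideanSpace ℝ (Fin d)) (t : ℝ≥0) :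
    Integrable (fun ω => extendZero (fun y => (y i - x₀ i) ^ 2) (𝕏.X t ω)) (𝕏.P x₀) := by
  obtain ⟨B, hB⟩ := 𝕏.exists_lintegral_sq_bound hN i x₀ t
  refine (𝕏.c₀Measurable t _).integrable_sq i x₀ (C := ENNReal.ofReal B) ENNReal.ofReal_ne_top
    fun n => ?_
  simpa using hB n t ⟨t.2, le_rfl⟩

theorem integrable_traj_sq (hN : IsPureJump 𝕏 N) (i : Fin d) (x₀ : EuclideanSpace ℝ (Fin d))
    (t : ℝ≥0) :
    Integrable (fun q => extendZero (fun y => (y i - x₀ i) ^ 2) (𝕏.traj q))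
      ((volume.restrict (Set.Ioc (0 : ℝ) t)).prod (𝕏.P x₀)) := by
  obtain ⟨B, hB⟩ := 𝕏.exists_lintegral_sq_bound hN i x₀ t
  have hm := 𝕏.c₀Measurable_traj (volume.restrict (Set.Ioc (0 : ℝ) t)) x₀
  refine hm.integrable_sq i x₀
    (C := ∫⁻ _ in Set.Ioc (0 : ℝ) t, ENNReal.ofReal B) ?_ fun n => ?_
  · rw [lintegral_const]
    exact ENNReal.mul_ne_top ENNReal.ofReal_ne_top (measure_ne_top _ _)
  · rw [← coe_testC₀, lintegral_prod _ (hm (testC₀ i 2 x₀ n)).aemeasurable.ennreal_ofReal]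
    refine setLIntegral_mono measurable_const fun s hs => ?_
    exact hB n s ⟨hs.1.le, hs.2⟩

theorem memLp_coord_sub (hN : IsPureJump 𝕏 N) (i : Fin d) (x₀ : EuclideanSpace ℝ (Fin d))
    (t : ℝ≥0) : MemLp (fun ω => 𝕏.coord i t ω - x₀ i) 2 (𝕏.P x₀) := by
  have hm : Measurable fun ω => 𝕏.coord i t ω - x₀ i := by
    have := measurable_position.comp (𝕏.measurable_X t)
    exact ((EuclideanSpace.proj (𝕜 := ℝ) i).continuous.measurable.comp this).sub_const _
  rw [memLp_two_iff_integrable_sq hm.aestronglyMeasurable]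
  refine (𝕏.integrable_sq hN i x₀ t).congr ?_
  filter_upwards [𝕏.ae_ne_infty hN i x₀ t] with ω hω
  rw [extendZero_eq_of_ne_infty _ hω]
  rfl

theorem memLp_traj_sub (hN : IsPureJump 𝕏 N) (i : Fin d) (x₀ : EuclideanSpace ℝ (Fin d))
    (t : ℝ≥0) : MemLp (fun q => position (𝕏.traj q) i - x₀ i) 2
      ((volume.restrict (Set.Ioc (0 : ℝ) t)).prod (𝕏.P x₀)) := by
  have hm := (𝕏.c₀Measurable_traj (volume.restrict (Set.Ioc (0 : ℝ) t)) x₀).position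
  have hm' : AEMeasurable (fun q => position (𝕏.traj q) i - x₀ i)
      ((volume.restrict (Set.Ioc (0 : ℝ) t)).prod (𝕏.P x₀)) :=
    ((EuclideanSpace.proj (𝕜 := ℝ) i).continuous.measurable.comp_aemeasurable hm).sub_const (x₀ i)
  rw [memLp_two_iff_integrable_sq hm'.aestronglyMeasurable]
  refine (𝕏.integrable_traj_sq hN i x₀ t).congr ?_
  filter_upwards [𝕏.ae_traj_ne_infty hN i x₀ (volume.restrict (Set.Ioc (0 : ℝ) t))] with q hq
  rw [extendZero_eq_of_ne_infty _ hq]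

/-! ### Removing the truncation. -/

theorem tendsto_generator (hN : IsPureJump 𝕏 N) (i : Fin d) {k : ℕ} (hk : k ≤ 2)
    (x₀ x : EuclideanSpace ℝ (Fin d)) :
    Tendsto (fun n => 𝕏.generator (testC₀ i k x₀ n) x) atTop
      (𝓝 (jumpOperator N (fun y => (y i - x₀ i) ^ k) x)) := by
  obtain ⟨M, hM0, hM⟩ := exists_secondMomentBound hN.second_moment
  obtain ⟨K, hK0, hK⟩ := exists_testFun_taylor_bound_of_le_two i k hk
  simp only [hN.generator_testC₀]
  exact hM.tendsto_jumpOperator (fun n => (contDiff_testFun i k x₀ n).continuous)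
    (eventually_testFun_eventuallyEq i k x₀) x fun n z => hK x₀ n x z

/-- No measurability of $x\mapsto N(x,\cdot)$ is assumed; it is recovered here from the continuity
of $Lu_n$, in the form of a pointwise limit. -/
theorem measurable_jumpOperator (hN : IsPureJump 𝕏 N) (i : Fin d) {k : ℕ} (hk : k ≤ 2)
    (x₀ : EuclideanSpace ℝ (Fin d)) :
    Measurable (jumpOperator N fun y => (y i - x₀ i) ^ k) :=
  measurable_of_tendsto_metrizable
    (fun n => (𝕏.generator (testC₀ i k x₀ n)).continuous.measurable)
    (tendsto_pi_nhds.2 fun x => 𝕏.tendsto_generator hN i hk x₀ x)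

theorem measurable_largeJumpMean (hN : IsPureJump 𝕏 N) (i : Fin d) :
    Measurable (largeJumpMean N i) := by
  have h := 𝕏.measurable_jumpOperator hN i one_le_two 0
  have e : jumpOperator N (fun y => (y i - (0 : EuclideanSpace ℝ (Fin d)) i) ^ 1) =
      largeJumpMean N i := funext fun x => jumpOperator_coord i 0 x
  rwa [e] at h

theorem measurable_jumpSecondMoment (hN : IsPureJump 𝕏 N) (i : Fin d) :
    Measurable (jumpSecondMoment N i) := by
  obtain ⟨M, hM0, hM⟩ := exists_secondMomentBound hN.second_moment
  have h := 𝕏.measurable_jumpOperator hN i le_rfl 0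
  have hl := 𝕏.measurable_largeJumpMean hN i
  have e : jumpSecondMoment N i = fun x =>
      jumpOperator N (fun y => (y i - (0 : EuclideanSpace ℝ (Fin d)) i) ^ 2) x -
        2 * ((x i - (0 : EuclideanSpace ℝ (Fin d)) i) * largeJumpMean N i x) :=
    funext fun x => by rw [hM.jumpOperator_coord_sq]; ring
  rw [e]
  fun_prop

/-- Dynkin's formula for the powers of a coordinate. -/
theorem integral_coord_sub_pow (hN : IsPureJump 𝕏 N) (i : Fin d) {k : ℕ} (hk : k = 1 ∨ k = 2)
    (x₀ : EuclideanSpace ℝ (Fin d)) (t : ℝ≥0) :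
    ∫ ω, (𝕏.coord i t ω - x₀ i) ^ k ∂(𝕏.P x₀) =
      ∫ q, jumpOperator N (fun y => (y i - x₀ i) ^ k) (position (𝕏.traj q))
        ∂((volume.restrict (Set.Ioc (0 : ℝ) t)).prod (𝕏.P x₀)) := by
  have hk2 : k ≤ 2 := by omega
  set ν := (volume.restrict (Set.Ioc (0 : ℝ) t)).prod (𝕏.P x₀) with hν
  obtain ⟨C, hC0, hC⟩ := 𝕏.exists_generator_bound hN i hk
  have hlim1 : Tendsto (fun n => 𝕏.semigroup t (testC₀ i k x₀ n) x₀) atTop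
      (𝓝 (∫ ω, (𝕏.coord i t ω - x₀ i) ^ k ∂(𝕏.P x₀))) := by
    have hp : Integrable (fun ω => |𝕏.coord i t ω - x₀ i| ^ k) (𝕏.P x₀) := by
      have h := 𝕏.memLp_coord_sub hN i x₀ t
      rcases hk with rfl | rfl
      · simpa using (h.integrable (by norm_num)).abs
      · simpa using h.integrable_sq
    simp only [semigroup_apply]
    refine tendsto_integral_of_dominated_convergence _
      (fun n => 𝕏.c₀Measurable t _ _) hp (fun n => ae_of_all _ fun ω => ?_) ?_
    · by_cases hω : 𝕏.X t ω = OnePoint.infty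
      · rw [hω, extendZero_infty, norm_zero]
        positivity
      · rw [extendZero_eq_of_ne_infty _ hω]
        exact abs_testFun_le i k x₀ n _
    · filter_upwards [𝕏.ae_ne_infty hN i x₀ t] with ω hω
      have := tendsto_extendZero_testFun i k x₀ (𝕏.X t ω)
      rwa [extendZero_eq_of_ne_infty (fun y => (y i - x₀ i) ^ k) hω] at this
  have hlim2 : Tendsto (fun n => ∫ q, extendZero (𝕏.generator (testC₀ i k x₀ n)) (𝕏.traj q) ∂ν)
      atTop (𝓝 (∫ q, jumpOperator N (fun y => (y i - x₀ i) ^ k) (position (𝕏.traj q)) ∂ν)) := by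
    refine tendsto_integral_of_dominated_convergence _
      (fun n => 𝕏.c₀Measurable_traj _ _ _)
      (((integrable_const 1).add (𝕏.integrable_traj_sq hN i x₀ t)).const_mul C)
      (fun n => ae_of_all _ fun q => abs_extendZero_le_one_add hC0 (hC x₀ n) _) ?_
    filter_upwards [𝕏.ae_traj_ne_infty hN i x₀ (volume.restrict (Set.Ioc (0 : ℝ) t))] with q hq
    simp only [extendZero_eq_of_ne_infty _ hq]
    exact 𝕏.tendsto_generator hN i hk2 x₀ _
  refine tendsto_nhds_unique hlim1 (hlim2.congr fun n => ?_)
  -- Since $k\ge1$, the initial term of Dynkin's formula vanishes.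
  have h0 : testC₀ i k x₀ n x₀ = 0 := by
    rcases hk with rfl | rfl <;> simp [testFun]
  have h := 𝕏.integral_semigroup_generator (hN.hasGenerator i k x₀ n) x₀ t
  rw [h0, sub_zero, intervalIntegral.integral_of_le t.coe_nonneg] at h
  rw [← h, hν, integral_prod]
  · exact integral_congr_ae (ae_of_all _ fun s =>
      (𝕏.semigroup_apply s.toNNReal (𝕏.generator (testC₀ i k x₀ n)) x₀).symm)
  · exact Integrable.of_bound (𝕏.c₀Measurable_traj _ _ _) _
      (ae_of_all _ fun q => abs_extendZero_le_norm _ _)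

end FellerProcess

end FellerMoment

end

/-- Besides the formulas, the conclusion records what makes every term in them meaningful: `X_t` is
almost surely in `ℝᵈ`, and the integrands of the time integrals are absolutely integrable for
`ds ⊗ ℙ_{x₀}` on `(0, t] × Ω`. -/
theorem mainTheorem2 {d : ℕ} {Ω : Type*} [MeasurableSpace Ω]
    (𝕏 : FellerMoment.FellerProcess d Ω)
    (N : EuclideanSpace ℝ (Fin d) → Measure (EuclideanSpace ℝ (Fin d)))
    (hN : FellerMoment.IsPureJump 𝕏 N)
    (t : ℝ≥0) (ht : 0 < t) (i : Fin d) (x₀ : EuclideanSpace ℝ (Fin d)) :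
    (∀ᵐ ω ∂(𝕏.P x₀), 𝕏.X t ω ≠ OnePoint.infty) ∧
    MemLp (𝕏.coord i t) 2 (𝕏.P x₀) ∧
    Integrable
      (fun p : ℝ × Ω =>
        FellerMoment.jumpSecondMoment N i (FellerMoment.position (𝕏.X p.1.toNNReal p.2)))
      ((volume.restrict (Set.Ioc (0 : ℝ) t)).prod (𝕏.P x₀)) ∧
    Integrable
      (fun p : ℝ × Ω => (𝕏.coord i p.1.toNNReal p.2 - x₀ i) *
        FellerMoment.largeJumpMean N i (FellerMoment.position (𝕏.X p.1.toNNReal p.2)))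
      ((volume.restrict (Set.Ioc (0 : ℝ) t)).prod (𝕏.P x₀)) ∧
    Integrable
      (fun p : ℝ × Ω =>
        FellerMoment.largeJumpMean N i (FellerMoment.position (𝕏.X p.1.toNNReal p.2)))
      ((volume.restrict (Set.Ioc (0 : ℝ) t)).prod (𝕏.P x₀)) ∧
    (∫ ω, (𝕏.coord i t ω - x₀ i) ^ 2 ∂(𝕏.P x₀)) =
      (∫ ω, (∫ s in (0 : ℝ)..t,
        FellerMoment.jumpSecondMoment N i (FellerMoment.position (𝕏.X s.toNNReal ω)))
          ∂(𝕏.P x₀)) +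
      2 * (∫ ω, (∫ s in (0 : ℝ)..t, (𝕏.coord i s.toNNReal ω - x₀ i) *
        FellerMoment.largeJumpMean N i (FellerMoment.position (𝕏.X s.toNNReal ω)))
          ∂(𝕏.P x₀)) ∧
    (∫ ω, (𝕏.coord i t ω - x₀ i) ∂(𝕏.P x₀)) =
      ∫ ω, (∫ s in (0 : ℝ)..t,
        FellerMoment.largeJumpMean N i (FellerMoment.position (𝕏.X s.toNNReal ω)))
          ∂(𝕏.P x₀) := by
  obtain ⟨M, hM0, hM⟩ := FellerMoment.exists_secondMomentBound hN.second_moment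
  have hpos := (𝕏.c₀Measurable_traj (volume.restrict (Set.Ioc (0 : ℝ) t)) x₀).position
  have hJ : Integrable (fun p : ℝ × Ω =>
      FellerMoment.jumpSecondMoment N i (FellerMoment.position (𝕏.X p.1.toNNReal p.2)))
      ((volume.restrict (Set.Ioc (0 : ℝ) t)).prod (𝕏.P x₀)) :=
    Integrable.of_bound ((𝕏.measurable_jumpSecondMoment hN i).comp_aemeasurable
      hpos).aestronglyMeasurable M (ae_of_all _ fun q => hM.abs_jumpSecondMoment_le i _)
  have hLm : AEStronglyMeasurable (fun p : ℝ × Ω =>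
      FellerMoment.largeJumpMean N i (FellerMoment.position (𝕏.X p.1.toNNReal p.2)))
      ((volume.restrict (Set.Ioc (0 : ℝ) t)).prod (𝕏.P x₀)) :=
    ((𝕏.measurable_largeJumpMean hN i).comp_aemeasurable hpos).aestronglyMeasurable
  have hL : Integrable (fun p : ℝ × Ω =>
      FellerMoment.largeJumpMean N i (FellerMoment.position (𝕏.X p.1.toNNReal p.2)))
      ((volume.restrict (Set.Ioc (0 : ℝ) t)).prod (𝕏.P x₀)) :=
    Integrable.of_bound hLm M (ae_of_all _ fun q => hM.abs_largeJumpMean_le i _)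
  have hXL : Integrable (fun p : ℝ × Ω => (𝕏.coord i p.1.toNNReal p.2 - x₀ i) *
      FellerMoment.largeJumpMean N i (FellerMoment.position (𝕏.X p.1.toNNReal p.2)))
      ((volume.restrict (Set.Ioc (0 : ℝ) t)).prod (𝕏.P x₀)) :=
    -- The measure is finite, so $L^2$ gives $L^1$, and the other factor is bounded by $M$.
    ((𝕏.memLp_traj_sub hN i x₀ t).integrable (by norm_num)).mul_bdd hLm
      (ae_of_all _ fun q => hM.abs_largeJumpMean_le i _)
  refine ⟨𝕏.ae_ne_infty hN i x₀ t, ?_, hJ, hXL, hL, ?_, ?_⟩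
  · have h := (𝕏.memLp_coord_sub hN i x₀ t).add (memLp_const (x₀ i))
    refine h.ae_eq (ae_of_all _ fun ω => ?_)
    exact sub_add_cancel _ _
  · rw [𝕏.integral_coord_sub_pow hN i (Or.inr rfl)]
    simp only [hM.jumpOperator_coord_sq, intervalIntegral.integral_of_le t.coe_nonneg]
    -- Fubini with the time integral inside, the order used in the statement.
    rw [← integral_prod_symm _ hJ, ← integral_prod_symm _ hXL, ← integral_const_mul,
      ← integral_add hJ (hXL.const_mul 2)]
    rfl
  · have h := 𝕏.integral_coord_sub_pow hN i (Or.inl rfl) x₀ t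
    simp only [FellerMoment.jumpOperator_coord] at h
    simp only [pow_one] at h
    rw [h]
    simp only [intervalIntegral.integral_of_le t.coe_nonneg]
    rw [← integral_prod_symm _ hL]
    rfl
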